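/- Let $A$ be a commutative ring with unit, let $p=X^n+c_1X^{n-1}+\dots+c_n\in A[X]$ be a monic polynomial of degree $n\ge 0$ (put $c_i=0$ for $i>n$), and let $k\ge 1$. Let $M=XA[X]$, a free $A$-module with basis $\epsilon^i=X^i$ ($i\ge 1$), and let $D=(D_0,D_1,\dots)$ be the sequence of $A$-endomorphisms of the exterior algebra $\bigwedge M$ such that $\alpha\mapsto\sum_{h\ge0}D_h(\alpha)t^h$ is an $A$-algebra homomorphism $\bigwedge M\to(\bigwedge M)[[t]]$ and $D_h\epsilon^i=\epsilon^{i+h}$ for all $h\ge 0$, $i\ge 1$. The $D_h$ commute with each other and preserve $\bigwedge^kM$; let $A[D_1,\dots,D_k]\subseteq \mathrm{End}_A(\bigwedge^kM)$ be the commutative $A$-algebra generated by the restrictions of $D_1,\dots,D_k$ to $\bigwedge^kM$, and let $J_k(p)$ be its ideal $$J_k(p)=\{P(D)\in A[D_1,\dots,D_k]\;:\;P(D)(\epsilon^1\wedge\dots\wedge\epsilon^k)\in \textstyle\bigwedge^{k-1}M\wedge pM\},$$ where $\bigwedge^{k-1}M\wedge pM$ is the $A$-submodule of $\bigwedge^kM$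 spanned by the elements $\alpha\wedge pm$ with $\alpha\in\bigwedge^{k-1}M$, $m\in M$. Define $\widetilde D_m=\widetilde D_m(T_1,\dots,T_k)\in A[T_1,\dots,T_k]$ by $$\sum_{m\ge0}\widetilde D_m t^m=\frac{1}{1-\Delta_1t+\Delta_2t^2-\dots+(-1)^k\Delta_kt^k},\qquad \Delta_h=\det(T_{j+1-i})_{1\le i,j\le h},$$ with $T_0=1$ and $T_j=0$ for $j<0$, and $\widetilde D_m=0$ for $m<0$; and put, for every integer $m$, $$\widetilde D_m(\mathbf T_k,p)=\widetilde D_m+\sum_{i=1}^{m}c_i\widetilde D_{m-i}$$ (the sum is empty for $m\le 0$). Write $\widetilde D_m(\mathbf D_k,p)$ for its value at $T_i=D_i$ ($1\le i\le k$). Then $$J_k(p)=\bigl(\widetilde D_{n-k+1}(\mathbf D_k,p),\dots,\widetilde D_{n}(\mathbf D_k,p)\bigr).$$ The same holds at the level of polynomials: for $P\in A[T_1,\dots,T_k]$, one has $P(D)(\epsilon^1\wedge\dots\wedge\epsilon^k)\in\bigwedge^{k-1}M\wedge pM$ if and only if $P$ lies in the ideal of $A[T_1,\dots,T_k]$ generated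 by $\widetilde D_{n-k+1}(\mathbf T_k,p),\dots,\widetilde D_n(\mathbf T_k,p)$. -/

import Mathlib

open Polynomial

namespace GrassmannAlgebra

section Derivation

variable {A : Type*} [CommRing A] {M : Type*} [AddCommGroup M] [Module A M]

/-- The `A`-linear map `M → (⋀ M)⟦t⟧`, `m ↦ ∑ f_i(m) t^i`, attached to a sequence of endomorphisms
of `M`. -/
noncomputable def genMap (f : ℕ → Module.End A M) : M →ₗ[A] PowerSeries (ExteriorAlgebra A M) where
  toFun m := PowerSeries.mk fun i => ExteriorAlgebra.ι A (f i m)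
  map_add' x y := by
    ext i
    simp
  map_smul' a x := by
    ext i
    simp

theorem genMap_sq (f : ℕ → Module.End A M) (m : M) : genMap f m * genMap f m = 0 := by
  ext h
  rw [PowerSeries.coeff_mul]
  simp only [genMap, LinearMap.coe_mk, AddHom.coe_mk, PowerSeries.coeff_mk, map_zero]
  refine Finset.sum_involution (fun x _ => x.swap) ?_ ?_ ?_ ?_
  · intro x _
    exact ExteriorAlgebra.ι_add_mul_swap _ _
  · intro x _ hne heq
    apply hne
    have : x.2 = x.1 := congrArg Prod.fst heq
    rw [this]
    exact ExteriorAlgebra.ι_sq_zero _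
  · intro x hx
    simpa [add_comm] using hx
  · intro x _
    simp

/-- The derivation `D_t : ⋀ M → (⋀ M)⟦t⟧` (an `A`-algebra homomorphism) extending
`m ↦ ∑ f_i(m) t^i`. -/
noncomputable def derivation (f : ℕ → Module.End A M) :
    ExteriorAlgebra A M →ₐ[A] PowerSeries (ExteriorAlgebra A M) :=
  ExteriorAlgebra.lift A ⟨genMap f, genMap_sq f⟩

/-- The `h`-th coefficient `D_h ∈ End_A(⋀ M)` of `D_t`. -/
noncomputable def derivCoeff (f : ℕ → Module.End A M) (h : ℕ) :
    Module.End A (ExteriorAlgebra A M) where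
  toFun α := PowerSeries.coeff h (derivation f α)
  map_add' x y := by simp
  map_smul' a x := by simp

theorem derivCoeff_ι (f : ℕ → Module.End A M) (h : ℕ) (m : M) :
    derivCoeff f h (ExteriorAlgebra.ι A m) = ExteriorAlgebra.ι A (f h m) := by
  simp [derivCoeff, derivation, genMap]

theorem derivCoeff_algebraMap (f : ℕ → Module.End A M) (h : ℕ) (a : A) :
    derivCoeff f h (algebraMap A _ a) = if h = 0 then algebraMap A _ a else 0 := by
  simp only [derivCoeff, LinearMap.coe_mk, AddHom.coe_mk, AlgHom.commutes]
  rw [PowerSeries.algebraMap_apply, PowerSeries.coeff_C]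

/-- The Leibniz rule of order `h`. -/
theorem derivCoeff_mul (f : ℕ → Module.End A M) (h : ℕ) (α β : ExteriorAlgebra A M) :
    derivCoeff f h (α * β) =
      ∑ x ∈ Finset.HasAntidiagonal.antidiagonal h, derivCoeff f x.1 α * derivCoeff f x.2 β := by
  simp [derivCoeff, PowerSeries.coeff_mul]

theorem derivCoeff_comm (f : ℕ → Module.End A M) (hf : ∀ i j, f i * f j = f j * f i) (i j : ℕ)
    (α : ExteriorAlgebra A M) :
    derivCoeff f i (derivCoeff f j α) = derivCoeff f j (derivCoeff f i α) := by
  induction α using ExteriorAlgebra.induction generalizing i j with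
  | algebraMap a =>
    simp only [derivCoeff_algebraMap]
    split_ifs <;> simp [derivCoeff_algebraMap, *]
  | ι m =>
    simp only [derivCoeff_ι]
    exact congrArg _ (LinearMap.congr_fun (hf i j) m)
  | mul a b ha hb =>
    simp only [derivCoeff_mul, map_sum]
    rw [Finset.sum_comm]
    refine Finset.sum_congr rfl fun x _ => Finset.sum_congr rfl fun y _ => ?_
    rw [ha, hb]
  | add a b ha hb => simp only [map_add, ha, hb]

theorem derivCoeff_mem (f : ℕ → Module.End A M) (k h : ℕ) (α : ExteriorAlgebra A M)
    (hα : α ∈ ⋀[A]^k M) : derivCoeff f h α ∈ ⋀[A]^k M := by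
  induction k generalizing h α with
  | zero =>
    rw [ExteriorAlgebra.exteriorPower, pow_zero] at hα ⊢
    obtain ⟨a, rfl⟩ := Submodule.mem_one.1 hα
    rw [derivCoeff_algebraMap]
    split_ifs
    · exact hα
    · exact zero_mem _
  | succ k ih =>
    rw [ExteriorAlgebra.exteriorPower, pow_succ] at hα ⊢
    induction hα using Submodule.mul_induction_on' with
    | mem_mul_mem a ha b hb =>
      rw [derivCoeff_mul]
      refine sum_mem fun x _ => Submodule.mul_mem_mul (ih _ _ ha) ?_
      obtain ⟨m, rfl⟩ := hb
      rw [derivCoeff_ι]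
      exact ⟨_, rfl⟩
    | add a _ b _ ha hb =>
      rw [map_add]
      exact add_mem ha hb

end Derivation

variable (A : Type*) [CommRing A]

/-- The module `M = X A[X]`, as the ideal of `A[X]` generated by `X`. It is an `A[X]`-module and an
`A`-module. -/
def XMod : Type _ := ↥(Ideal.span {(X : A[X])} : Ideal A[X])

noncomputable instance : AddCommGroup (XMod A) :=
  inferInstanceAs (AddCommGroup ↥(Ideal.span {(X : A[X])} : Ideal A[X]))

noncomputable instance : Module A[X] (XMod A) :=
  inferInstanceAs (Module A[X] ↥(Ideal.span {(X : A[X])} : Ideal A[X]))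

noncomputable instance : Module A (XMod A) :=
  inferInstanceAs (Module A ↥(Ideal.span {(X : A[X])} : Ideal A[X]))

instance : IsScalarTower A A[X] (XMod A) :=
  inferInstanceAs (IsScalarTower A A[X] ↥(Ideal.span {(X : A[X])} : Ideal A[X]))

variable {A} in
/-- Multiplication by a polynomial, as an `A`-endomorphism of `M = X A[X]`. -/
noncomputable def mulEnd (q : A[X]) : Module.End A (XMod A) := Algebra.lsmul A A (XMod A) q

/-- `ε^i = X^i` for `i = 1, 2, …`; here `eps i` is `ε^{i+1} = X^{i+1}`, `i = 0, 1, …`. -/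
noncomputable def eps (i : ℕ) : XMod A :=
  ⟨X ^ (i + 1), Ideal.mem_span_singleton.2 (dvd_pow_self X i.succ_ne_zero)⟩

/-- The canonical derivation `D = (D_0, D_1, …)` of `⋀ M`: on `M` the operator `D_h` is
multiplication by `X^h`, that is `D_h ε^i = ε^{i+h}`. -/
noncomputable def D (h : ℕ) : Module.End A (ExteriorAlgebra A (XMod A)) :=
  derivCoeff (fun i => mulEnd (X ^ i)) h

theorem D_eps (h i : ℕ) :
    D A h (ExteriorAlgebra.ι A (eps A i)) = ExteriorAlgebra.ι A (eps A (i + h)) := by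
  rw [D, derivCoeff_ι]
  congr 1
  apply Subtype.ext
  change (X : A[X]) ^ h * X ^ (i + 1) = X ^ (i + h + 1)
  ring

/-- The restriction of `D_h` to `⋀^k M`. -/
noncomputable def Dk (k h : ℕ) : Module.End A (⋀[A]^k (XMod A)) :=
  (D A h).restrict fun α hα => derivCoeff_mem _ k h α hα

theorem Dk_comm (k i j : ℕ) : Dk A k i * Dk A k j = Dk A k j * Dk A k i := by
  refine LinearMap.ext fun α => Subtype.ext ?_
  refine derivCoeff_comm _ (fun i j => ?_) i j α.1
  rw [mulEnd, mulEnd, ← map_mul, ← map_mul, mul_comm]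

/-- The ring `A[D_1, …, D_k] ⊆ End_A(⋀^k M)`. -/
noncomputable abbrev opRing (k : ℕ) : Subalgebra A (Module.End A (⋀[A]^k (XMod A))) :=
  Algebra.adjoin A (Set.range fun i : Fin k => Dk A k (i + 1))

theorem opRing_comm (k : ℕ) (x y : opRing A k) : x * y = y * x := by
  have := Algebra.isMulCommutative_adjoin A
    (s := Set.range fun i : Fin k => Dk A k (i + 1)) (by
      rintro _ ⟨i, rfl⟩ _ ⟨j, rfl⟩
      exact Dk_comm A k _ _)
  exact mul_comm' x y

noncomputable instance opRingCommRing (k : ℕ) : CommRing (opRing A k) :=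
  { Algebra.semiringToRing A (A := opRing A k) with mul_comm := opRing_comm A k }

/-- The evaluation `P ↦ P(D)` from `A[T_1, …, T_k]` to `A[D_1, …, D_k]`; the variable `T_{i+1}` is
`MvPolynomial.X i`, for `i : Fin k`. -/
noncomputable def evD (k : ℕ) : MvPolynomial (Fin k) A →ₐ[A] opRing A k :=
  MvPolynomial.aeval fun i : Fin k =>
    (⟨Dk A k (i + 1), Algebra.subset_adjoin ⟨i, rfl⟩⟩ : opRing A k)

/-- `ε^1 ∧ … ∧ ε^k ∈ ⋀^k M`. -/
noncomputable def epsTop (k : ℕ) : ⋀[A]^k (XMod A) :=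
  exteriorPower.ιMulti A k fun i : Fin k => eps A i

variable {A}

/-- `⋀^{k-1} M ∧ pM`, as an `A`-submodule of `⋀ M`: the span of all `α ∧ pm` with
`α ∈ ⋀^{k-1} M` and `m ∈ M` (used for `k ≥ 1`). -/
noncomputable def wedgeP (k : ℕ) (p : A[X]) : Submodule A (ExteriorAlgebra A (XMod A)) :=
  (⋀[A]^(k - 1) (XMod A)) * (LinearMap.range (mulEnd p)).map (ExteriorAlgebra.ι A)

theorem D_mem_wedgeP (k : ℕ) (p : A[X]) (h : ℕ) (α : ExteriorAlgebra A (XMod A))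
    (hα : α ∈ wedgeP k p) : D A h α ∈ wedgeP k p := by
  rw [wedgeP] at hα ⊢
  induction hα using Submodule.mul_induction_on' with
  | mem_mul_mem a ha b hb =>
    rw [D, derivCoeff_mul]
    refine sum_mem fun x _ => Submodule.mul_mem_mul (derivCoeff_mem _ _ _ _ ha) ?_
    obtain ⟨_, ⟨m, rfl⟩, rfl⟩ := hb
    rw [derivCoeff_ι]
    refine ⟨_, ⟨mulEnd (X ^ x.2) m, rfl⟩, ?_⟩
    congr 1
    simp only [mulEnd, Algebra.lsmul_coe, smul_smul, mul_comm]
  | add a _ b _ ha hb =>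
    rw [map_add]
    exact add_mem ha hb

theorem opRing_mem_wedgeP (k : ℕ) (p : A[X]) (x : Module.End A (⋀[A]^k (XMod A)))
    (hx : x ∈ opRing A k) (α : ⋀[A]^k (XMod A))
    (hα : (α : ExteriorAlgebra A (XMod A)) ∈ wedgeP k p) :
    (x α : ExteriorAlgebra A (XMod A)) ∈ wedgeP k p := by
  induction hx using Algebra.adjoin_induction generalizing α with
  | mem x hx =>
    obtain ⟨i, rfl⟩ := hx
    exact D_mem_wedgeP k p _ _ hα
  | algebraMap a =>
    rw [Module.algebraMap_end_apply]
    exact Submodule.smul_mem _ a hα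
  | add x y _ _ hx hy => exact add_mem (hx α hα) (hy α hα)
  | mul x y _ _ hx hy => exact hx _ (hy α hα)

/-- The ideal `J_k(p)` of `A[D_1, …, D_k]`: the operators that send `ε^1 ∧ … ∧ ε^k` into
`⋀^{k-1} M ∧ pM`. -/
noncomputable def J (k : ℕ) (p : A[X]) : Ideal (opRing A k) where
  carrier := {x | ((x.1 (epsTop A k) : ⋀[A]^k (XMod A)) : ExteriorAlgebra A (XMod A)) ∈ wedgeP k p}
  zero_mem' := zero_mem (wedgeP k p)
  add_mem' hx hy := (wedgeP k p).add_mem hx hy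
  smul_mem' c _ hx := opRing_mem_wedgeP k p c.1 c.2 _ hx

variable (A)

/-- The sequence `T_0 = 1`, `T_1, …, T_k` the variables, `T_j = 0` for `j < 0`. (The value for
`j > k` plays no role below.) -/
noncomputable def T (k : ℕ) (j : ℤ) : MvPolynomial (Fin k) A :=
  if j = 0 then 1
  else if h : 1 ≤ j ∧ j ≤ k then MvPolynomial.X ⟨(j - 1).toNat, by omega⟩
  else 0

/-- The Schur polynomial `Δ_{(i_1,…,i_h)}(T) = det (T_{i_b - a})_{1 ≤ a, b ≤ h}`. -/
noncomputable def schur (k : ℕ) {h : ℕ} (I : Fin h → ℤ) : MvPolynomial (Fin k) A :=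
  Matrix.det (Matrix.of fun a b : Fin h => T A k (I b - ((a : ℕ) + 1 : ℤ)))

/-- The power series `1 - Δ_{(2)} t + Δ_{(2,3)} t² - … + (-1)^k Δ_{(2,3,…,k+1)} t^k`. -/
noncomputable def denom (k : ℕ) : PowerSeries (MvPolynomial (Fin k) A) :=
  PowerSeries.mk fun h =>
    if h ≤ k then (-1) ^ h * schur A k (fun b : Fin h => ((b : ℕ) + 2 : ℤ)) else 0

theorem constantCoeff_denom (k : ℕ) :
    PowerSeries.constantCoeff (denom A k) = ((1 : (MvPolynomial (Fin k) A)ˣ) : _) := by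
  simp [denom, schur, ← PowerSeries.coeff_zero_eq_constantCoeff_apply]

/-- `D̃_m(T_1, …, T_k)`: the coefficient of `t^m` in the inverse of the power series `denom`,
and `0` for `m < 0`. -/
noncomputable def Dtilde (k : ℕ) (m : ℤ) : MvPolynomial (Fin k) A :=
  if 0 ≤ m then PowerSeries.coeff m.toNat (PowerSeries.invOfUnit (denom A k) 1) else 0

theorem denom_mul_mk_Dtilde (k : ℕ) :
    denom A k * PowerSeries.mk (fun m : ℕ => Dtilde A k m) = 1 := by
  have : PowerSeries.mk (fun m : ℕ => Dtilde A k m) = PowerSeries.invOfUnit (denom A k) 1 := by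
    ext1 m
    simp [Dtilde]
  rw [this]
  exact PowerSeries.mul_invOfUnit _ _ (constantCoeff_denom A k)

variable {A}

/-- The coefficients `c_i` in `p = X^n + c_1 X^{n-1} + … + c_n`, with `c_i = 0` for `i > n`. -/
noncomputable def coeffC (p : A[X]) (i : ℕ) : A :=
  if i ≤ p.natDegree then p.coeff (p.natDegree - i) else 0

/-- `D̃_m(T_1, …, T_k; p) = D̃_m + ∑_{i=1}^m c_i D̃_{m-i}`. -/
noncomputable def DtildeP (k : ℕ) (p : A[X]) (m : ℤ) : MvPolynomial (Fin k) A :=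
  Dtilde A k m + ∑ i ∈ Finset.Icc 1 m.toNat, coeffC p i • Dtilde A k (m - i)

end GrassmannAlgebra

/-!
Write `g` for multiplication by `X` on `M` and `B = A[T_1, …, T_k]`. The vectors
`(D̃_i, D̃_{i-1}, …, D̃_{i-k+1}) ∈ B^k` satisfy a linear recurrence over `B`, so the `A`-linear map
`ε^{i+1} ↦ (D̃_i, …, D̃_{i-k+1})` carries `g` to a `B`-linear endomorphism of `B^k`. Taking
determinants gives a linear form `λ : ⋀^k M → B`. As `⋀^k B^k` has rank one, the endomorphisms `D_h`
act on it by scalars, whence `λ (D_h α) = D̃_h λ α`. In particular `D̃_h = T_h` for `h ≤ k` and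
`λ (ε^1 ∧ … ∧ ε^k) = 1` give `λ (P(D) (ε^1 ∧ … ∧ ε^k)) = P`. Expanding the determinant along the row
of `p m` shows that `λ` maps `⋀^{k-1} M ∧ pM` into the ideal generated by the coordinates of the
vector of `p ε^1`, which are the `D̃_{n-a}(T, p)` for `0 ≤ a < k`.

Conversely, `∑ D_h t^h` is inverse on `⋀^k M` to the multiplicative extension of `1 - g t`, which
has degree at most `k` there, so it is determined by `D_1, …, D_k` in the same way as `∑ D̃_h t^h`
by `T_1, …, T_k`, and `D_h = D̃_h(D_1, …, D_k)`. Since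
`D_h (ε^1 ∧ … ∧ ε^k) = ε^1 ∧ … ∧ ε^{k-1} ∧ ε^{k+h}`, the generators of the ideal send
`ε^1 ∧ … ∧ ε^k` to `ε^1 ∧ … ∧ ε^{k-1} ∧ p ε^j` for `1 ≤ j ≤ k`.
-/

namespace GrassmannAlgebra

section PowerSeries

theorem X_pow_dvd_sub_of_mul_eq_one {R : Type*} [Ring R] {a b c d : PowerSeries R} {n : ℕ}
    (hab : a * b = 1) (hcd : c * d = 1) (h : PowerSeries.X ^ n ∣ c - b) :
    PowerSeries.X ^ n ∣ a - d := by
  obtain ⟨e, he⟩ := h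
  have key : a - d = a * (c - b) * d := by
    rw [mul_sub, sub_mul, mul_assoc, hcd, hab, mul_one, one_mul]
  refine ⟨a * e * d, ?_⟩
  rw [key, he, ← mul_assoc a, (PowerSeries.commute_X_pow a n).eq]
  simp only [mul_assoc]

/-- The upper triangular Toeplitz matrix of size `n` with the coefficients of `φ` along its
diagonals: the matrix of multiplication by `φ` modulo `t^n`, used to read off inverses of power
series by Cramer's rule. -/
noncomputable def toeplitz {R : Type*} [Semiring R] (n : ℕ) (φ : PowerSeries R) :
    Matrix (Fin n) (Fin n) R :=
  Matrix.of fun i j => if i ≤ j then PowerSeries.coeff (j - i) φ else 0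

theorem toeplitz_one {R : Type*} [Semiring R] (n : ℕ) :
    toeplitz n (1 : PowerSeries R) = 1 := by
  ext i j
  simp only [toeplitz, Matrix.of_apply, PowerSeries.coeff_one, Matrix.one_apply]
  grind

theorem toeplitz_mul {R : Type*} [Semiring R] (n : ℕ) (φ ψ : PowerSeries R) :
    toeplitz n (φ * ψ) = toeplitz n φ * toeplitz n ψ := by
  ext i l
  simp only [toeplitz, Matrix.mul_apply, Matrix.of_apply, ite_mul, mul_ite, zero_mul, mul_zero,
    ← ite_and, ← Finset.sum_filter, PowerSeries.coeff_mul]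
  split_ifs with hil
  · refine (Finset.sum_nbij (fun j : Fin n => ((j : ℕ) - i, (l : ℕ) - j)) ?_ ?_ ?_ ?_).symm
    · intro j hj
      rw [Finset.mem_filter_univ] at hj
      rw [Finset.HasAntidiagonal.mem_antidiagonal]
      grind
    · intro j hj j' hj' h
      rw [Finset.mem_coe, Finset.mem_filter_univ] at hj hj'
      grind
    · intro x hx
      rw [Finset.mem_coe, Finset.HasAntidiagonal.mem_antidiagonal] at hx
      refine ⟨⟨i + x.1, by omega⟩, ?_, by grind⟩
      rw [Finset.mem_coe, Finset.mem_filter_univ]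
      grind
    · simp
  · rw [Finset.sum_eq_zero]
    grind

theorem det_toeplitz {R : Type*} [CommRing R] (n : ℕ) (φ : PowerSeries R) :
    (toeplitz n φ).det = PowerSeries.constantCoeff φ ^ n := by
  rw [Matrix.det_of_isUpperTriangular]
  · simp [toeplitz]
  · intro i j hij
    exact if_neg (not_le.2 hij)

theorem coeff_eq_det_of_mul_eq_one {R : Type*} [CommRing R] {φ ψ : PowerSeries R}
    (hφψ : φ * ψ = 1) (hφ : PowerSeries.constantCoeff φ = 1) (n : ℕ) :
    PowerSeries.coeff n ψ = (-1) ^ n * Matrix.det (Matrix.of fun a b : Fin n =>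
      if (a : ℕ) ≤ b + 1 then PowerSeries.coeff (b + 1 - a) φ else 0) := by
  have hadj : toeplitz (n + 1) ψ = (toeplitz (n + 1) φ).adjugate := by
    rw [← mul_one (Matrix.adjugate _), ← toeplitz_one, ← hφψ, toeplitz_mul, ← mul_assoc,
      Matrix.adjugate_mul, det_toeplitz, hφ, one_pow, one_smul, one_mul]
  have hentry := congrFun₂ hadj 0 (Fin.last n)
  rw [Matrix.adjugate_fin_succ_eq_det_submatrix] at hentry
  simpa only [toeplitz, Matrix.submatrix, Matrix.of_apply, Fin.le_def, Fin.succAbove_zero,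
    Fin.succAbove_last, Fin.val_castSucc, Fin.val_succ, Fin.val_zero, Fin.val_last, zero_le,
    if_true, Nat.sub_zero, zero_add, add_zero] using hentry

end PowerSeries

section Dtilde

variable (A : Type*) [CommRing A]

/-- The generating series `∑ T_j t^j` of the variables `T_0 = 1, T_1, …, T_k`. -/
noncomputable def genT (k : ℕ) : PowerSeries (MvPolynomial (Fin k) A) :=
  PowerSeries.mk fun j => T A k j

theorem T_zero (k : ℕ) : T A k 0 = 1 := by simp [T]

theorem T_of_neg (k : ℕ) {j : ℤ} (hj : j < 0) : T A k j = 0 := by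
  rw [T, if_neg (by omega), dif_neg (by omega)]

theorem T_val_succ (k : ℕ) (i : Fin k) : T A k ((i : ℕ) + 1 : ℕ) = MvPolynomial.X i := by
  rw [T, if_neg (by omega), dif_pos (by omega)]
  congr 1
  ext
  simp

theorem constantCoeff_genT (k : ℕ) : PowerSeries.constantCoeff (genT A k) = 1 := by
  simp [genT, ← PowerSeries.coeff_zero_eq_constantCoeff_apply, T_zero]

theorem coeff_denom_of_gt {k h : ℕ} (hh : k < h) : PowerSeries.coeff h (denom A k) = 0 := by
  rw [denom, PowerSeries.coeff_mk, if_neg (by omega)]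

theorem X_pow_dvd_denom_sub {k : ℕ} {ψ : PowerSeries (MvPolynomial (Fin k) A)}
    (hψ : genT A k * ψ = 1) : PowerSeries.X ^ (k + 1) ∣ denom A k - ψ := by
  refine PowerSeries.X_pow_dvd_iff.2 fun h hh => ?_
  rw [map_sub, sub_eq_zero, coeff_eq_det_of_mul_eq_one hψ (constantCoeff_genT A k), denom,
    PowerSeries.coeff_mk, if_pos (by omega), schur]
  congr 3
  ext1 a
  funext b
  split_ifs with hab
  · rw [genT, PowerSeries.coeff_mk]
    congr 1
    omega
  · exact T_of_neg A k (by omega)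

theorem exists_genT_mul_eq_one (k : ℕ) : ∃ ψ, genT A k * ψ = 1 :=
  ⟨_, PowerSeries.mul_invOfUnit _ 1 (constantCoeff_genT A k)⟩

theorem Dtilde_natCast_of_le {k m : ℕ} (hm : m ≤ k) : Dtilde A k m = T A k m := by
  obtain ⟨ψ, hψ⟩ := exists_genT_mul_eq_one A k
  have hdvd := X_pow_dvd_sub_of_mul_eq_one hψ (denom_mul_mk_Dtilde A k)
    (X_pow_dvd_denom_sub A hψ)
  have hcoeff := PowerSeries.X_pow_dvd_iff.1 hdvd m (by omega)
  simpa [genT, sub_eq_zero, eq_comm] using hcoeff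

theorem Dtilde_zero (k : ℕ) : Dtilde A k 0 = 1 := by
  simpa [T_zero] using Dtilde_natCast_of_le A (Nat.zero_le k)

theorem Dtilde_of_neg (k : ℕ) {m : ℤ} (hm : m < 0) : Dtilde A k m = 0 := by
  rw [Dtilde, if_neg (by omega)]

theorem sum_coeff_denom_mul_Dtilde (k m : ℕ) :
    ∑ r ∈ Finset.range (k + 1), PowerSeries.coeff r (denom A k) * Dtilde A k (m - r) =
      if m = 0 then 1 else 0 := by
  rw [← PowerSeries.coeff_one, ← denom_mul_mk_Dtilde A k, PowerSeries.coeff_mul,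
    Finset.Nat.sum_antidiagonal_eq_sum_range_succ_mk]
  refine Finset.sum_congr_of_eq_on_inter (fun r _ hr => ?_) (fun r _ hr => ?_) fun r _ hr => ?_
  · rw [Dtilde_of_neg A k (by grind), mul_zero]
  · rw [coeff_denom_of_gt A (by grind), zero_mul]
  · rw [PowerSeries.coeff_mk, Nat.cast_sub (by grind)]

theorem Dtilde_succ (k m : ℕ) : Dtilde A k ((m : ℤ) + 1) =
    -∑ r : Fin k, PowerSeries.coeff (r + 1) (denom A k) * Dtilde A k ((m : ℤ) - r) := by
  have hsum := sum_coeff_denom_mul_Dtilde A k (m + 1)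
  rw [Finset.sum_range_succ', if_neg m.succ_ne_zero, PowerSeries.coeff_zero_eq_constantCoeff_apply,
    constantCoeff_denom, Finset.sum_range] at hsum
  rw [eq_neg_iff_add_eq_zero, add_comm]
  simpa using hsum

variable {A} in
theorem map_Dtilde {B : Type*} [Ring B] {k : ℕ} (φ : MvPolynomial (Fin k) A →+* B)
    {d e : PowerSeries B} (hed : e * d = 1) (he : ∀ r, k < r → PowerSeries.coeff r e = 0)
    (hd : ∀ i ≤ k, φ (T A k i) = PowerSeries.coeff i d) (m : ℕ) :
    φ (Dtilde A k m) = PowerSeries.coeff m d := by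
  obtain ⟨ψ, hψ⟩ := exists_genT_mul_eq_one A k
  have hψmap : (genT A k).map φ * ψ.map φ = 1 := by rw [← map_mul, hψ, map_one]
  have hd_dvd : PowerSeries.X ^ (k + 1) ∣ (genT A k).map φ - d := by
    refine PowerSeries.X_pow_dvd_iff.2 fun i hi => ?_
    rw [map_sub, PowerSeries.coeff_map, genT, PowerSeries.coeff_mk, hd i (by omega), sub_self]
  have he_dvd := X_pow_dvd_sub_of_mul_eq_one hed hψmap hd_dvd
  have hdenom : (denom A k).map φ = e := by
    ext r
    rcases le_or_gt r k with hr | hr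
    · have h₁ := PowerSeries.X_pow_dvd_iff.1 (X_pow_dvd_denom_sub A hψ) r (by omega)
      have h₂ := PowerSeries.X_pow_dvd_iff.1 he_dvd r (by omega)
      rw [map_sub, sub_eq_zero] at h₁ h₂
      rw [h₂, PowerSeries.coeff_map, PowerSeries.coeff_map, h₁]
    · rw [he r hr, PowerSeries.coeff_map, coeff_denom_of_gt A hr, map_zero]
  have hinv := congrArg (PowerSeries.map φ) ((mul_comm _ _).trans (denom_mul_mk_Dtilde A k))
  rw [map_mul, map_one, hdenom] at hinv
  rw [← left_inv_eq_right_inv hinv hed, PowerSeries.coeff_map, PowerSeries.coeff_mk]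

end Dtilde

section Derivation

variable {A : Type*} [CommRing A] {M : Type*} [AddCommGroup M] [Module A M]

open Finset.HasAntidiagonal in
theorem sum_antidiagonal_interchange {B : Type*} [AddCommMonoid B] (F : ℕ → ℕ → ℕ → ℕ → B)
    (n : ℕ) :
    ∑ x ∈ antidiagonal n, ∑ y ∈ antidiagonal x.1, ∑ z ∈ antidiagonal x.2, F y.1 y.2 z.1 z.2 =
      ∑ x ∈ antidiagonal n, ∑ y ∈ antidiagonal x.2, ∑ z ∈ antidiagonal x.1,
        F z.1 y.1 z.2 y.2 := by
  simp only [Finset.sum_sigma']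
  refine Finset.sum_nbij'
    (fun w => ⟨(w.2.1.1 + w.2.2.1, w.2.1.2 + w.2.2.2), (w.2.1.2, w.2.2.2), (w.2.1.1, w.2.2.1)⟩)
    (fun w => ⟨(w.2.2.1 + w.2.1.1, w.2.2.2 + w.2.1.2), (w.2.2.1, w.2.1.1), (w.2.2.2, w.2.1.2)⟩)
    ?_ ?_ ?_ ?_ ?_ <;> grind [mem_antidiagonal]

theorem derivCoeff_apply (f : ℕ → Module.End A M) (h : ℕ) (α : ExteriorAlgebra A M) :
    derivCoeff f h α = PowerSeries.coeff h (derivation f α) :=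
  rfl

theorem derivation_ι (f : ℕ → Module.End A M) (m : M) :
    derivation f (ExteriorAlgebra.ι A m) = genMap f m := by
  simp [derivation]

theorem derivation_coeff_one (α : ExteriorAlgebra A M) :
    derivation (fun i => PowerSeries.coeff i (1 : PowerSeries (Module.End A M))) α =
      PowerSeries.C α := by
  induction α using ExteriorAlgebra.induction with
  | algebraMap a => rw [AlgHom.commutes, PowerSeries.algebraMap_apply]
  | ι m =>
    ext i
    rw [derivation_ι, PowerSeries.coeff_C]
    simp only [genMap, LinearMap.coe_mk, AddHom.coe_mk, PowerSeries.coeff_mk, PowerSeries.coeff_one]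
    split_ifs <;> simp
  | mul α β hα hβ => rw [map_mul, map_mul, hα, hβ]
  | add α β hα hβ => rw [map_add, map_add, hα, hβ]

theorem derivCoeff_coeff_mul (F G : PowerSeries (Module.End A M)) (h : ℕ)
    (α : ExteriorAlgebra A M) :
    derivCoeff (fun i => PowerSeries.coeff i (F * G)) h α =
      ∑ x ∈ Finset.HasAntidiagonal.antidiagonal h,
        derivCoeff (fun i => PowerSeries.coeff i F) x.1
          (derivCoeff (fun i => PowerSeries.coeff i G) x.2 α) := by
  induction α using ExteriorAlgebra.induction generalizing h with
  | algebraMap a =>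
    rcases h with _ | h
    · simp [derivCoeff_algebraMap]
    · rw [derivCoeff_algebraMap, if_neg h.succ_ne_zero, Finset.sum_eq_zero]
      intro x hx
      rw [derivCoeff_algebraMap]
      split_ifs with hx₂
      · rw [derivCoeff_algebraMap, if_neg (by grind [Finset.HasAntidiagonal.mem_antidiagonal])]
      · rw [map_zero]
  | ι m =>
    simp only [derivCoeff_ι, PowerSeries.coeff_mul, LinearMap.sum_apply, Module.End.mul_apply,
      map_sum]
  | mul α β hα hβ =>
    simp only [derivCoeff_mul, hα, hβ, Finset.sum_mul_sum, map_sum]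
    exact sum_antidiagonal_interchange (fun i j i' j' =>
      derivCoeff (fun n => PowerSeries.coeff n F) i
          (derivCoeff (fun n => PowerSeries.coeff n G) j α) *
        derivCoeff (fun n => PowerSeries.coeff n F) i'
          (derivCoeff (fun n => PowerSeries.coeff n G) j' β)) h
  | add α β hα hβ => simp only [map_add, Finset.sum_add_distrib, hα, hβ]

/-- The generating series `∑ D_h t^h`, over `End_A(⋀^k M)`, of the coefficients of the derivation
attached to the sequence of coefficients of `F`. -/
noncomputable def derivSeries (k : ℕ) (F : PowerSeries (Module.End A M)) :
    PowerSeries (Module.End A (⋀[A]^k M)) :=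
  PowerSeries.mk fun h =>
    (derivCoeff (fun i => PowerSeries.coeff i F) h).restrict fun α hα => derivCoeff_mem _ k h α hα

theorem coe_coeff_derivSeries (k : ℕ) (F : PowerSeries (Module.End A M)) (h : ℕ) (α : ⋀[A]^k M) :
    (PowerSeries.coeff h (derivSeries k F) α : ExteriorAlgebra A M) =
      derivCoeff (fun i => PowerSeries.coeff i F) h α := by
  rw [derivSeries, PowerSeries.coeff_mk]
  rfl

theorem derivSeries_one (k : ℕ) : derivSeries k (1 : PowerSeries (Module.End A M)) = 1 := by
  refine PowerSeries.ext fun h => LinearMap.ext fun α => Subtype.ext ?_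
  rw [coe_coeff_derivSeries, derivCoeff_apply, derivation_coeff_one, PowerSeries.coeff_C,
    PowerSeries.coeff_one]
  split_ifs <;> rfl

theorem derivSeries_mul (k : ℕ) (F G : PowerSeries (Module.End A M)) :
    derivSeries k (F * G) = derivSeries k F * derivSeries k G := by
  refine PowerSeries.ext fun h => LinearMap.ext fun α => Subtype.ext ?_
  rw [coe_coeff_derivSeries, derivCoeff_coeff_mul, PowerSeries.coeff_mul, LinearMap.sum_apply,
    AddSubmonoidClass.coe_finsetSum]
  simp only [Module.End.mul_apply, coe_coeff_derivSeries]

theorem coeff_zero_derivSeries (k : ℕ) {F : PowerSeries (Module.End A M)}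
    (hF : PowerSeries.coeff 0 F = 1) : PowerSeries.coeff 0 (derivSeries k F) = 1 := by
  refine LinearMap.ext fun α => Subtype.ext ?_
  rw [coe_coeff_derivSeries, Module.End.one_apply]
  generalize (α : ExteriorAlgebra A M) = α
  induction α using ExteriorAlgebra.induction with
  | algebraMap a => simp [derivCoeff_algebraMap]
  | ι m => rw [derivCoeff_ι, hF, Module.End.one_apply]
  | mul α β hα hβ => simp [derivCoeff_mul, hα, hβ]
  | add α β hα hβ => rw [map_add, hα, hβ]

theorem derivCoeff_eq_zero_of_gt {f : ℕ → Module.End A M} (hf : ∀ i, 1 < i → f i = 0) {k h : ℕ}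
    (hh : k < h) {α : ExteriorAlgebra A M} (hα : α ∈ ⋀[A]^k M) : derivCoeff f h α = 0 := by
  induction k generalizing h α with
  | zero =>
    rw [ExteriorAlgebra.exteriorPower, pow_zero] at hα
    obtain ⟨a, rfl⟩ := Submodule.mem_one.1 hα
    rw [derivCoeff_algebraMap, if_neg (by omega)]
  | succ k ih =>
    rw [ExteriorAlgebra.exteriorPower, pow_succ] at hα
    induction hα using Submodule.mul_induction_on' with
    | mem_mul_mem a ha b hb =>
      obtain ⟨m, rfl⟩ := hb
      rw [derivCoeff_mul]
      refine Finset.sum_eq_zero fun x hx => ?_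
      rw [Finset.HasAntidiagonal.mem_antidiagonal] at hx
      rcases lt_or_ge k x.1 with hx₁ | hx₁
      · rw [ih hx₁ ha, zero_mul]
      · rw [derivCoeff_ι, hf _ (by omega), LinearMap.zero_apply, map_zero, mul_zero]
    | add a _ b _ ha hb => rw [map_add, ha, hb, add_zero]

theorem one_sub_C_mul_X_mul_mk_pow {R : Type*} [Ring R] (g : R) :
    (1 - PowerSeries.C g * PowerSeries.X) * PowerSeries.mk (g ^ ·) = 1 := by
  ext i
  rw [sub_mul, one_mul, mul_assoc, map_sub, PowerSeries.coeff_C_mul, PowerSeries.coeff_one]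
  rcases i with _ | i
  · simp
  · simp [PowerSeries.coeff_succ_X_mul, pow_succ']

theorem derivSeries_one_sub_mul (k : ℕ) (g : Module.End A M) :
    derivSeries k (1 - PowerSeries.C g * PowerSeries.X) *
      derivSeries k (PowerSeries.mk (g ^ ·)) = 1 := by
  rw [← derivSeries_mul, one_sub_C_mul_X_mul_mk_pow, derivSeries_one]

theorem coeff_derivSeries_one_sub_of_gt {k h : ℕ} (hh : k < h) (g : Module.End A M) :
    PowerSeries.coeff h (derivSeries k (1 - PowerSeries.C g * PowerSeries.X)) = 0 := by
  refine LinearMap.ext fun α => Subtype.ext ?_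
  rw [coe_coeff_derivSeries, derivCoeff_eq_zero_of_gt (fun i hi => ?_) hh α.2]
  · rfl
  · simp [PowerSeries.coeff_one, PowerSeries.coeff_X, hi.ne', (zero_lt_one.trans hi).ne']

theorem ιMulti_mul_ι (k : ℕ) (v : Fin k → M) (m : M) :
    ExteriorAlgebra.ιMulti A k v * ExteriorAlgebra.ι A m =
      ExteriorAlgebra.ιMulti A (k + 1) (Fin.snoc v m : Fin (k + 1) → M) := by
  rw [ExteriorAlgebra.ιMulti_apply, ExteriorAlgebra.ιMulti_apply, List.ofFn_succ',
    List.concat_eq_append, List.prod_append]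
  simp

/-- The wedge `v ∧ g v ∧ … ∧ g^{k-1} v` of consecutive iterates of `g`. -/
noncomputable def wedgeIterates (g : Module.End A M) (v : M) (k : ℕ) : ExteriorAlgebra A M :=
  ExteriorAlgebra.ιMulti A k fun b : Fin k => (g ^ (b : ℕ)) v

theorem wedgeIterates_mul_ι (g : Module.End A M) (v : M) (k : ℕ) :
    wedgeIterates g v k * ExteriorAlgebra.ι A ((g ^ k) v) = wedgeIterates g v (k + 1) := by
  rw [wedgeIterates, wedgeIterates, ιMulti_mul_ι]
  congr 1
  ext b
  cases b using Fin.lastCases <;> simp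

theorem genMap_pow_eq (g : Module.End A M) (m : M) :
    genMap (fun i => g ^ i) m =
      PowerSeries.C (ExteriorAlgebra.ι A m) + PowerSeries.X * genMap (fun i => g ^ i) (g m) := by
  ext i
  rcases i with _ | i
  · simp [genMap]
  · rw [map_add, PowerSeries.coeff_succ_X_mul, PowerSeries.coeff_C, if_neg i.succ_ne_zero, zero_add]
    simp [genMap, pow_succ]

/- `D_t (g^k v) = g^k v + t D_t (g^{k+1} v)`, and `D_t (g^{k+1} v)` squares to zero. -/
theorem derivation_wedgeIterates_succ (g : Module.End A M) (v : M) (k : ℕ) :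
    derivation (fun i => g ^ i) (wedgeIterates g v (k + 1)) =
      PowerSeries.C (wedgeIterates g v k) * genMap (fun i => g ^ i) ((g ^ k) v) := by
  induction k with
  | zero =>
    rw [← wedgeIterates_mul_ι]
    simp [wedgeIterates, derivation_ι]
  | succ k ih =>
    have hnext := genMap_pow_eq g ((g ^ k) v)
    rw [← Module.End.mul_apply, ← pow_succ'] at hnext
    rw [← wedgeIterates_mul_ι g v (k + 1), map_mul, ih, derivation_ι, hnext, mul_add, add_mul,
      ← map_mul, wedgeIterates_mul_ι, mul_assoc, mul_assoc, genMap_sq, mul_zero, mul_zero,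
      add_zero]

theorem derivCoeff_wedgeIterates_succ (g : Module.End A M) (v : M) (k h : ℕ) :
    derivCoeff (fun i => g ^ i) h (wedgeIterates g v (k + 1)) =
      wedgeIterates g v k * ExteriorAlgebra.ι A ((g ^ (k + h)) v) := by
  rw [derivCoeff_apply, derivation_wedgeIterates_succ, PowerSeries.coeff_C_mul]
  simp [genMap, add_comm k, pow_add]

end Derivation

section TopForm

variable {R : Type*} [CommRing R] {N : Type*} [AddCommGroup N] [Module R N] {k : ℕ}

/-- The linear form on `⋀ N` that is the determinant with respect to `e` in degree `k` and zero in
the other degrees. -/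
noncomputable def topForm (e : Module.Basis (Fin k) R N) : ExteriorAlgebra R N →ₗ[R] R :=
  ExteriorAlgebra.liftAlternating (Pi.single k e.det)

theorem topForm_ιMulti (e : Module.Basis (Fin k) R N) (v : Fin k → N) :
    topForm e (ExteriorAlgebra.ιMulti R k v) = e.det v := by
  rw [topForm, ExteriorAlgebra.liftAlternating_apply_ιMulti, Pi.single_eq_same]

theorem eq_topForm_mul (e : Module.Basis (Fin k) R N) (φ : ExteriorAlgebra R N →ₗ[R] R)
    {α : ExteriorAlgebra R N} (hα : α ∈ ⋀[R]^k N) :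
    φ α = topForm e α * φ (ExteriorAlgebra.ιMulti R k e) := by
  rw [← ExteriorAlgebra.ιMulti_span_fixedDegree] at hα
  suffices h : Set.EqOn φ
      (φ (ExteriorAlgebra.ιMulti R k e) • topForm e : ExteriorAlgebra R N →ₗ[R] R)
      (Set.range (ExteriorAlgebra.ιMulti R k)) by
    rw [LinearMap.eqOn_span h hα, LinearMap.smul_apply, smul_eq_mul, mul_comm]
  rintro _ ⟨v, rfl⟩
  have hdet := DFunLike.congr_fun
    (AlternatingMap.eq_smul_basis_det (f := φ.compAlternatingMap (ExteriorAlgebra.ιMulti R k)) e) v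
  simpa [topForm_ιMulti] using hdet

theorem topForm_derivCoeff_mul (e : Module.Basis (Fin k) R N) (f : ℕ → Module.End R N) (h : ℕ)
    {α β : ExteriorAlgebra R N} (hα : α ∈ ⋀[R]^k N) (hβ : β ∈ ⋀[R]^k N) :
    topForm e (derivCoeff f h α) * topForm e β = topForm e (derivCoeff f h β) * topForm e α := by
  have heig : ∀ {γ}, γ ∈ ⋀[R]^k N → topForm e (derivCoeff f h γ) = _ :=
    eq_topForm_mul e (topForm e ∘ₗ derivCoeff f h)
  rw [heig hα, heig hβ]
  ring

end TopForm

section MapExtend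

variable {A : Type*} [CommRing A] {M : Type*} [AddCommGroup M] [Module A M]
  {R : Type*} [CommRing R] [Algebra A R]
  {N : Type*} [AddCommGroup N] [Module A N] [Module R N] [IsScalarTower A R N]

/-- The homomorphism `⋀_A M → ⋀_R N` of `A`-algebras induced by an `A`-linear map `M → N` into an
`R`-module. -/
noncomputable def mapExtend (l : M →ₗ[A] N) : ExteriorAlgebra A M →ₐ[A] ExteriorAlgebra R N :=
  ExteriorAlgebra.lift A
    ⟨(ExteriorAlgebra.ι R).restrictScalars A ∘ₗ l, fun m => ExteriorAlgebra.ι_sq_zero (l m)⟩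

theorem mapExtend_ι (l : M →ₗ[A] N) (m : M) :
    mapExtend (R := R) l (ExteriorAlgebra.ι A m) = ExteriorAlgebra.ι R (l m) :=
  ExteriorAlgebra.lift_ι_apply A _ _ m

theorem mapExtend_ιMulti (l : M →ₗ[A] N) (k : ℕ) (v : Fin k → M) :
    mapExtend (R := R) l (ExteriorAlgebra.ιMulti A k v) =
      ExteriorAlgebra.ιMulti R k (l ∘ v) := by
  simp [ExteriorAlgebra.ιMulti_apply, map_list_prod, List.map_ofFn, mapExtend_ι, Function.comp_def]

theorem mapExtend_mem {l : M →ₗ[A] N} {k : ℕ} {α : ExteriorAlgebra A M} (hα : α ∈ ⋀[A]^k M) :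
    mapExtend (R := R) l α ∈ ⋀[R]^k N := by
  rw [← ExteriorAlgebra.ιMulti_span_fixedDegree] at hα
  refine (Submodule.span_le (p := ((⋀[R]^k N).restrictScalars A).comap
    (mapExtend (R := R) l).toLinearMap)).2 ?_ hα
  rintro _ ⟨v, rfl⟩
  rw [SetLike.mem_coe, Submodule.mem_comap, AlgHom.toLinearMap_apply, mapExtend_ιMulti]
  exact ExteriorAlgebra.ιMulti_range R k ⟨_, rfl⟩

theorem mapExtend_derivCoeff {l : M →ₗ[A] N} {f : ℕ → Module.End A M} {f' : ℕ → Module.End R N}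
    (hl : ∀ i m, l (f i m) = f' i (l m)) (h : ℕ) (α : ExteriorAlgebra A M) :
    mapExtend (R := R) l (derivCoeff f h α) = derivCoeff f' h (mapExtend l α) := by
  induction α using ExteriorAlgebra.induction generalizing h with
  | algebraMap a =>
    rw [AlgHom.commutes, IsScalarTower.algebraMap_apply A R (ExteriorAlgebra R N),
      derivCoeff_algebraMap, derivCoeff_algebraMap]
    split_ifs
    · rw [AlgHom.commutes, ← IsScalarTower.algebraMap_apply]
    · rw [map_zero]
  | ι m => rw [derivCoeff_ι, mapExtend_ι, mapExtend_ι, derivCoeff_ι, hl]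
  | mul α β hα hβ => simp only [derivCoeff_mul, map_sum, map_mul, hα, hβ]
  | add α β hα hβ => simp only [map_add, hα, hβ]

variable {k : ℕ} (e : Module.Basis (Fin k) R N) (l : M →ₗ[A] N)

/-- The linear form on `⋀ M` that is `v_1 ∧ … ∧ v_k ↦ det (l v_1, …, l v_k)` in degree `k` and zero
in the other degrees; the determinant is taken with respect to the basis `e`. -/
noncomputable def detForm :
    ExteriorAlgebra A M →ₗ[A] R :=
  (topForm e).restrictScalars A ∘ₗ (mapExtend l).toLinearMap

theorem detForm_ιMulti (v : Fin k → M) :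
    detForm e l (ExteriorAlgebra.ιMulti A k v) = e.det (l ∘ v) := by
  rw [← topForm_ιMulti, ← mapExtend_ιMulti]
  rfl

variable {l} in
theorem detForm_derivCoeff_mul {f : ℕ → Module.End A M} {f' : ℕ → Module.End R N}
    (hl : ∀ i m, l (f i m) = f' i (l m)) (h : ℕ) {α β : ExteriorAlgebra A M}
    (hα : α ∈ ⋀[A]^k M) (hβ : β ∈ ⋀[A]^k M) :
    detForm e l (derivCoeff f h α) * detForm e l β =
      detForm e l (derivCoeff f h β) * detForm e l α := by
  have hform : ∀ γ, detForm e l (derivCoeff f h γ) = topForm e (derivCoeff f' h (mapExtend l γ)) :=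
    fun γ => congrArg (topForm e) (mapExtend_derivCoeff hl h γ)
  rw [hform, hform]
  exact topForm_derivCoeff_mul e f' h (mapExtend_mem hα) (mapExtend_mem hβ)

end MapExtend

section XMod

variable {A : Type*} [CommRing A]

theorem toSpanSingleton_eps_zero_bijective :
    Function.Bijective (LinearMap.toSpanSingleton A[X] (XMod A) (eps A 0)) := by
  have hval (q : A[X]) : (LinearMap.toSpanSingleton A[X] (XMod A) (eps A 0) q).1 = q * X := by
    change q * X ^ (0 + 1) = _
    rw [zero_add, pow_one]
  refine ⟨fun q r h => ?_, fun m => ?_⟩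
  · have hX := congrArg Subtype.val h
    rw [hval, hval] at hX
    exact isRegular_X.right hX
  · obtain ⟨q, hq⟩ := Ideal.mem_span_singleton'.1 m.2
    exact ⟨q, Subtype.ext ((hval q).trans hq)⟩

theorem mulEnd_apply (q : A[X]) (m : XMod A) : mulEnd q m = q • m := rfl

theorem mulEnd_pow (q : A[X]) (i : ℕ) : mulEnd (q ^ i) = mulEnd q ^ i := by
  rw [mulEnd, mulEnd, map_pow]

theorem X_pow_smul_eps (h i : ℕ) : (X ^ h : A[X]) • eps A i = eps A (i + h) := by
  apply Subtype.ext
  change (X : A[X]) ^ h * X ^ (i + 1) = X ^ (i + h + 1)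
  ring

theorem mulEnd_eq_sum (q : A[X]) (i : ℕ) :
    mulEnd q (eps A i) = ∑ j ∈ Finset.range (q.natDegree + 1), q.coeff j • eps A (i + j) := by
  conv_lhs => rw [mulEnd_apply, q.as_sum_range_C_mul_X_pow, Finset.sum_smul]
  simp only [mul_smul, X_pow_smul_eps, ← algebraMap_eq, algebraMap_smul]

variable (A) in
/-- The basis `ε^1, ε^2, …` of `M = X A[X]`. -/
noncomputable def epsBasis : Module.Basis ℕ A (XMod A) :=
  (basisMonomials A).map
    ((LinearEquiv.ofBijective _ toSpanSingleton_eps_zero_bijective).restrictScalars A)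

theorem epsBasis_apply (i : ℕ) : epsBasis A i = eps A i := by
  rw [epsBasis, Module.Basis.map_apply, congrFun (coe_basisMonomials A) i,
    monomial_one_right_eq_X_pow]
  exact (X_pow_smul_eps i 0).trans (congrArg _ (zero_add i))

theorem mulEnd_X_pow_eps_zero (i : ℕ) : (mulEnd (X : A[X]) ^ i) (eps A 0) = eps A i := by
  rw [← mulEnd_pow, mulEnd_apply, X_pow_smul_eps, zero_add]

variable (A) in
theorem D_eq (h : ℕ) : D A h = derivCoeff (fun i => mulEnd (X : A[X]) ^ i) h := by
  simp only [D, mulEnd_pow]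

theorem coe_epsTop (k : ℕ) :
    (epsTop A k : ExteriorAlgebra A (XMod A)) = wedgeIterates (mulEnd X) (eps A 0) k := by
  simp only [wedgeIterates, mulEnd_X_pow_eps_zero]
  rfl

theorem D_epsTop (k h : ℕ) : D A h (epsTop A (k + 1)) =
    (epsTop A k : ExteriorAlgebra A (XMod A)) * ExteriorAlgebra.ι A (eps A (k + h)) := by
  rw [D_eq, coe_epsTop, derivCoeff_wedgeIterates_succ, mulEnd_X_pow_eps_zero, coe_epsTop]

end XMod

section ShiftMap

variable {A : Type*} [CommRing A]

variable (A) in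
/-- The `A`-linear map sending `ε^{i+1}` to the vector `(D̃_i, D̃_{i-1}, …, D̃_{i-k})`. -/
noncomputable def shiftMap (k : ℕ) :
    XMod A →ₗ[A] Fin (k + 1) → MvPolynomial (Fin (k + 1)) A :=
  (epsBasis A).constr A fun i a => Dtilde A (k + 1) ((i : ℤ) - (a : ℕ))

theorem shiftMap_eps (k i : ℕ) (a : Fin (k + 1)) :
    shiftMap A k (eps A i) a = Dtilde A (k + 1) ((i : ℤ) - (a : ℕ)) := by
  rw [shiftMap, ← epsBasis_apply, Module.Basis.constr_basis]

variable (A) in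
/-- The companion endomorphism of the recurrence of the `D̃_m`: it shifts the coordinates by one and
computes the new first coordinate by the recurrence. -/
noncomputable def shiftEnd (k : ℕ) :
    Module.End (MvPolynomial (Fin (k + 1)) A) (Fin (k + 1) → MvPolynomial (Fin (k + 1)) A) :=
  LinearMap.pi (Fin.cons
    (-∑ r : Fin (k + 1), PowerSeries.coeff (r + 1) (denom A (k + 1)) • LinearMap.proj r)
    fun a => LinearMap.proj a.castSucc)

theorem shiftMap_mulEnd_X (k : ℕ) (m : XMod A) :
    shiftMap A k (mulEnd X m) = shiftEnd A k (shiftMap A k m) := by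
  suffices h : shiftMap A k ∘ₗ mulEnd X = (shiftEnd A k).restrictScalars A ∘ₗ shiftMap A k from
    LinearMap.congr_fun h m
  refine (epsBasis A).ext fun i => funext fun a => ?_
  have hX : mulEnd X (eps A i) = eps A (i + 1) := by
    simpa [mulEnd_apply] using X_pow_smul_eps (A := A) 1 i
  rw [epsBasis_apply, LinearMap.comp_apply, hX, shiftMap_eps]
  cases a using Fin.cases with
  | zero => simp [shiftEnd, shiftMap_eps, Dtilde_succ]
  | succ a => simp [shiftEnd, shiftMap_eps]

theorem shiftMap_mulEnd (k : ℕ) (q : A[X]) (m : XMod A) :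
    shiftMap A k (mulEnd q m) = aeval (shiftEnd A k) q (shiftMap A k m) := by
  induction q using Polynomial.induction_on generalizing m with
  | C a =>
    rw [aeval_C, Module.algebraMap_end_apply, ← map_smul, mulEnd_apply, ← algebraMap_eq,
      algebraMap_smul]
  | add q r hq hr =>
    rw [mulEnd_apply, add_smul, map_add, map_add, LinearMap.add_apply, ← hq, ← hr, mulEnd_apply,
      mulEnd_apply]
  | monomial i a ih =>
    rw [pow_succ, ← mul_assoc, mulEnd_apply, mul_smul, ← mulEnd_apply, ← mulEnd_apply, ih,
      shiftMap_mulEnd_X, map_mul (aeval _) _ X, aeval_X, Module.End.mul_apply]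

end ShiftMap

section ShiftForm

variable (A : Type*) [CommRing A]

/-- The linear form `λ` on `⋀^{k+1} M` with values in `A[T_1, …, T_{k+1}]`, given by
`ε^{i_0+1} ∧ … ∧ ε^{i_k+1} ↦ det (D̃_{i_b - a})`. -/
noncomputable def shiftForm (k : ℕ) :
    ExteriorAlgebra A (XMod A) →ₗ[A] MvPolynomial (Fin (k + 1)) A :=
  detForm (Pi.basisFun _ (Fin (k + 1))) (shiftMap A k)

theorem shiftForm_ιMulti (k : ℕ) (v : Fin (k + 1) → XMod A) :
    shiftForm A k (ExteriorAlgebra.ιMulti A (k + 1) v) =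
      Matrix.det (Matrix.of fun b => shiftMap A k (v b)) := by
  rw [shiftForm, detForm_ιMulti, Pi.basisFun_det_apply]
  rfl

theorem shiftForm_epsTop_mul_ι (k h : ℕ) :
    shiftForm A k (epsTop A k * ExteriorAlgebra.ι A (eps A (k + h))) = Dtilde A (k + 1) h := by
  rw [epsTop, exteriorPower.ιMulti_apply_coe, ιMulti_mul_ι, shiftForm_ιMulti,
    Matrix.det_of_isLowerTriangular]
  · rw [Fin.prod_univ_castSucc]
    simp [shiftMap_eps, Dtilde_zero]
  · intro b a (hba : b < a)
    obtain ⟨b, rfl⟩ := Fin.exists_castSucc_eq.2 (hba.trans_le a.le_last).ne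
    rw [Matrix.of_apply, Fin.snoc_castSucc, shiftMap_eps]
    exact Dtilde_of_neg _ _ (by simpa [Fin.lt_def] using hba)

theorem shiftForm_epsTop (k : ℕ) : shiftForm A k (epsTop A (k + 1)) = 1 := by
  rw [coe_epsTop, ← wedgeIterates_mul_ι, ← coe_epsTop, mulEnd_X_pow_eps_zero]
  exact (shiftForm_epsTop_mul_ι A k 0).trans (Dtilde_zero A (k + 1))

theorem shiftForm_D (k h : ℕ) (α : ⋀[A]^(k + 1) (XMod A)) :
    shiftForm A k (D A h α) = Dtilde A (k + 1) h * shiftForm A k α := by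
  have hpow : ∀ i m, shiftMap A k ((mulEnd X ^ i) m) = (shiftEnd A k ^ i) (shiftMap A k m) := by
    intro i m
    rw [← mulEnd_pow, shiftMap_mulEnd, map_pow, aeval_X]
  have hprop := detForm_derivCoeff_mul (Pi.basisFun _ (Fin (k + 1))) hpow h α.2
    (epsTop A (k + 1)).2
  rwa [← D_eq, D_epsTop, ← shiftForm, shiftForm_epsTop, mul_one, shiftForm_epsTop_mul_ι] at hprop

theorem shiftForm_evD (k : ℕ) (P : MvPolynomial (Fin (k + 1)) A) (α : ⋀[A]^(k + 1) (XMod A)) :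
    shiftForm A k ((evD A (k + 1) P).1 α) = P * shiftForm A k α := by
  induction P using MvPolynomial.induction_on generalizing α with
  | C a =>
    rw [← MvPolynomial.algebraMap_eq, AlgHom.commutes, ← Algebra.smul_def, ← map_smul]
    rfl
  | add P Q hP hQ =>
    rw [map_add, add_mul, ← hP, ← hQ]
    exact map_add (shiftForm A k) _ _
  | mul_X P i hP =>
    have hX : (evD A (k + 1) (P * MvPolynomial.X i)).1 α =
        (evD A (k + 1) P).1 (Dk A (k + 1) (i + 1) α) := by
      simp [evD]
    rw [hX, hP, mul_assoc, ← T_val_succ, ← Dtilde_natCast_of_le A i.2]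
    exact congrArg (P * ·) (shiftForm_D A k (i + 1) α)

end ShiftForm

section Membership

variable {A : Type*} [CommRing A] {p : A[X]}

theorem DtildeP_eq_sum_coeffC (k : ℕ) (hp : p.Monic) (m : ℤ) :
    DtildeP k p m = ∑ i ∈ Finset.range (p.natDegree + 1), coeffC p i • Dtilde A k (m - i) := by
  have hzero : Dtilde A k m = coeffC p 0 • Dtilde A k (m - (0 : ℕ)) := by
    simp [coeffC, hp.coeff_natDegree]
  have hinsert := Finset.sum_insert (s := Finset.Icc 1 m.toNat) (a := 0)
    (f := fun i : ℕ => coeffC p i • Dtilde A k (m - i)) (by simp)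
  rw [DtildeP, hzero]
  refine hinsert.symm.trans ?_
  refine Finset.sum_congr_of_eq_on_inter (fun i _ hi => ?_) (fun i _ hi => ?_) fun _ _ _ => rfl
  · rw [coeffC, if_neg (by grind), zero_smul]
  · rw [Dtilde_of_neg _ _ (by grind), smul_zero]

theorem DtildeP_eq_sum (k : ℕ) (hp : p.Monic) (m : ℤ) :
    DtildeP k p m = ∑ i ∈ Finset.range (p.natDegree + 1),
      p.coeff i • Dtilde A k (m - p.natDegree + i) := by
  rw [DtildeP_eq_sum_coeffC k hp, ← Finset.sum_range_reflect]
  refine Finset.sum_congr rfl fun i hi => ?_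
  rw [Finset.mem_range] at hi
  rw [coeffC, if_pos (by omega)]
  congr 2 <;> grind

theorem shiftMap_mulEnd_eps_zero (k : ℕ) (hp : p.Monic) (a : Fin (k + 1)) :
    shiftMap A k (mulEnd p (eps A 0)) a = DtildeP (k + 1) p ((p.natDegree : ℤ) - (a : ℕ)) := by
  rw [mulEnd_eq_sum, map_sum, Finset.sum_apply, DtildeP_eq_sum _ hp]
  refine Finset.sum_congr rfl fun i _ => ?_
  rw [map_smul, Pi.smul_apply, shiftMap_eps]
  congr 2
  push_cast
  ring

theorem shiftMap_mulEnd_mem {k : ℕ} {I : Ideal (MvPolynomial (Fin (k + 1)) A)}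
    (hI : ∀ a : Fin (k + 1), shiftMap A k (mulEnd p (eps A 0)) a ∈ I)
    (m : XMod A) (a : Fin (k + 1)) : shiftMap A k (mulEnd p m) a ∈ I := by
  obtain ⟨q, rfl⟩ := toSpanSingleton_eps_zero_bijective.2 m
  have hcomm : mulEnd p (q • eps A 0) = mulEnd q (mulEnd p (eps A 0)) := smul_comm p q _
  rw [LinearMap.toSpanSingleton_apply, hcomm, shiftMap_mulEnd]
  exact Ideal.map_pi I _ hI _ a

theorem shiftForm_mem_of_mem_wedgeP {k : ℕ} {I : Ideal (MvPolynomial (Fin (k + 1)) A)}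
    (hI : ∀ a : Fin (k + 1), shiftMap A k (mulEnd p (eps A 0)) a ∈ I)
    {α : ExteriorAlgebra A (XMod A)} (hα : α ∈ wedgeP (k + 1) p) : shiftForm A k α ∈ I := by
  have hgen (v : Fin k → XMod A) (m : XMod A) : shiftForm A k
      (ExteriorAlgebra.ιMulti A k v * ExteriorAlgebra.ι A (mulEnd p m)) ∈ I := by
    rw [ιMulti_mul_ι, shiftForm_ιMulti, Matrix.det_succ_row _ (Fin.last k)]
    refine I.sum_mem fun a _ => I.mul_mem_right _ (I.mul_mem_left _ ?_)
    rw [Matrix.of_apply, Fin.snoc_last]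
    exact shiftMap_mulEnd_mem hI m a
  suffices h : wedgeP (k + 1) p ≤ (I.restrictScalars A).comap (shiftForm A k) from h hα
  rw [wedgeP, Nat.add_sub_cancel, ← ExteriorAlgebra.ιMulti_span_fixedDegree, Submodule.mul_le]
  rintro β hβ _ ⟨_, ⟨m, rfl⟩, rfl⟩
  refine (Submodule.span_le (p := (I.restrictScalars A).comap
    (shiftForm A k ∘ₗ LinearMap.mulRight A (ExteriorAlgebra.ι A (mulEnd p m))))).2 ?_ hβ
  rintro _ ⟨v, rfl⟩
  exact hgen v m

end Membership

section Evaluation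

variable (A : Type*) [CommRing A]

theorem Dk_eq_coeff (k h : ℕ) :
    Dk A k h = PowerSeries.coeff h (derivSeries k (PowerSeries.mk (mulEnd (X : A[X]) ^ ·))) := by
  refine LinearMap.ext fun α => Subtype.ext ?_
  simp only [coe_coeff_derivSeries, PowerSeries.coeff_mk, ← D_eq]
  rfl

theorem evD_T {k i : ℕ} (hi : i ≤ k) : (evD A k (T A k i)).1 = Dk A k i := by
  rcases i with _ | i
  · rw [Nat.cast_zero, T_zero, map_one, Dk_eq_coeff, coeff_zero_derivSeries _ (by simp)]
    rfl
  · rw [T_val_succ A k ⟨i, hi⟩, evD, MvPolynomial.aeval_X]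

theorem evD_Dtilde (k m : ℕ) : (evD A k (Dtilde A k m)).1 = Dk A k m := by
  rw [Dk_eq_coeff]
  refine map_Dtilde ((opRing A k).val.toRingHom.comp (evD A k).toRingHom)
    (e := derivSeries k (1 - PowerSeries.C (mulEnd (X : A[X])) * PowerSeries.X)) ?_ ?_ ?_ m
  · exact derivSeries_one_sub_mul k _
  · exact fun r hr => coeff_derivSeries_one_sub_of_gt hr _
  · intro i hi
    rw [← Dk_eq_coeff, ← evD_T A hi]
    rfl

theorem epsTop_mul_ι_of_lt {k q : ℕ} (hq : q < k) :
    (epsTop A k : ExteriorAlgebra A (XMod A)) * ExteriorAlgebra.ι A (eps A q) = 0 := by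
  rw [epsTop, exteriorPower.ιMulti_apply_coe, ιMulti_mul_ι]
  refine (ExteriorAlgebra.ιMulti A (k + 1)).map_eq_zero_of_eq _
    (i := Fin.castSucc ⟨q, hq⟩) (j := Fin.last k) ?_ (Fin.castSucc_lt_last _).ne
  rw [Fin.snoc_castSucc, Fin.snoc_last]

theorem evD_Dtilde_epsTop (k q : ℕ) :
    ((evD A (k + 1) (Dtilde A (k + 1) ((q : ℤ) - k))).1 (epsTop A (k + 1)) :
      ExteriorAlgebra A (XMod A)) = epsTop A k * ExteriorAlgebra.ι A (eps A q) := by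
  rcases lt_or_ge q k with hq | hq
  · rw [epsTop_mul_ι_of_lt A hq, Dtilde_of_neg _ _ (by omega), map_zero]
    rfl
  · obtain ⟨h, rfl⟩ := Nat.exists_eq_add_of_le hq
    rw [Nat.cast_add, add_sub_cancel_left, evD_Dtilde, ← D_epsTop]
    rfl

theorem evD_surjective (k : ℕ) : Function.Surjective (evD A k) := by
  rw [← AlgHom.range_eq_top, evD, ← Algebra.adjoin_range_eq_range_aeval,
    ← Algebra.adjoin_adjoin_coe_preimage]
  congr 1
  ext x
  simp [Subtype.ext_iff]

end Evaluation

section Ideals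

variable {A : Type*} [CommRing A] {p : A[X]}

theorem evD_DtildeP_epsTop (k : ℕ) (hp : p.Monic) (j : ℕ) :
    ((evD A (k + 1) (DtildeP (k + 1) p ((p.natDegree : ℤ) - k + j))).1 (epsTop A (k + 1)) :
      ExteriorAlgebra A (XMod A)) = epsTop A k * ExteriorAlgebra.ι A (mulEnd p (eps A j)) := by
  let evalTop : MvPolynomial (Fin (k + 1)) A →ₗ[A] ExteriorAlgebra A (XMod A) :=
    (⋀[A]^(k + 1) (XMod A)).subtype ∘ₗ LinearMap.applyₗ (epsTop A (k + 1)) ∘ₗ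
      (opRing A (k + 1)).val.toLinearMap ∘ₗ (evD A (k + 1)).toLinearMap
  change evalTop _ = _
  rw [DtildeP_eq_sum _ hp, mulEnd_eq_sum, map_sum, map_sum, Finset.mul_sum]
  refine Finset.sum_congr rfl fun i _ => ?_
  rw [map_smul, map_smul, mul_smul_comm, ← evD_Dtilde_epsTop,
    show (p.natDegree : ℤ) - k + j - p.natDegree + i = (j + i : ℕ) - k by push_cast; ring]
  rfl

theorem evD_DtildeP_mem_J (k : ℕ) (hp : p.Monic) (j : ℕ) :
    evD A (k + 1) (DtildeP (k + 1) p ((p.natDegree : ℤ) - k + j)) ∈ J (k + 1) p := by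
  change ((evD A (k + 1) (DtildeP (k + 1) p _)).1 (epsTop A (k + 1)) :
    ExteriorAlgebra A (XMod A)) ∈ wedgeP (k + 1) p
  rw [evD_DtildeP_epsTop k hp]
  exact Submodule.mul_mem_mul (epsTop A k).2
    (Submodule.mem_map_of_mem (LinearMap.mem_range_self _ _))

theorem comap_evD_J_le {k : ℕ} {I : Ideal (MvPolynomial (Fin (k + 1)) A)} (hp : p.Monic)
    (hI : ∀ a ≤ k, DtildeP (k + 1) p ((p.natDegree : ℤ) - a) ∈ I) :
    (J (k + 1) p).comap (evD A (k + 1)) ≤ I := by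
  intro P hP
  have hform := shiftForm_evD A k P (epsTop A (k + 1))
  rw [shiftForm_epsTop, mul_one] at hform
  rw [← hform]
  refine shiftForm_mem_of_mem_wedgeP (fun a => ?_) hP
  rw [shiftMap_mulEnd_eps_zero k hp]
  exact hI a a.is_le

theorem comap_evD_J (k : ℕ) (hp : p.Monic) : (J (k + 1) p).comap (evD A (k + 1)) =
    Ideal.span {Q | ∃ j : ℕ, 1 ≤ j ∧ j ≤ k + 1 ∧
      Q = DtildeP (k + 1) p ((p.natDegree : ℤ) - (k + 1 : ℕ) + j)} := by
  apply le_antisymm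
  · refine comap_evD_J_le hp fun a ha => Ideal.subset_span ⟨k + 1 - a, by omega, by omega, ?_⟩
    congr 1
    omega
  · rw [Ideal.span_le]
    rintro _ ⟨j, hj, -, rfl⟩
    obtain ⟨j, rfl⟩ := Nat.exists_eq_add_of_le' hj
    have hindex : (p.natDegree : ℤ) - (k + 1 : ℕ) + (j + 1 : ℕ) = p.natDegree - k + j := by
      push_cast
      ring
    rw [hindex]
    exact evD_DtildeP_mem_J k hp j

end Ideals

end GrassmannAlgebra

theorem mainTheorem2 {A : Type*} [CommRing A] (p : Polynomial A) (hp : p.Monic) (n : ℕ)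
    (hn : p.natDegree = n) (k : ℕ) (hk : 1 ≤ k) :
    GrassmannAlgebra.J k p =
        Ideal.span {x | ∃ j : ℕ, 1 ≤ j ∧ j ≤ k ∧
          x = GrassmannAlgebra.evD A k (GrassmannAlgebra.DtildeP k p ((n : ℤ) - k + j))} ∧
      (GrassmannAlgebra.J k p).comap (GrassmannAlgebra.evD A k) =
        Ideal.span {Q | ∃ j : ℕ, 1 ≤ j ∧ j ≤ k ∧
          Q = GrassmannAlgebra.DtildeP k p ((n : ℤ) - k + j)} := by
  subst hn
  obtain ⟨k, rfl⟩ := Nat.exists_eq_add_of_le' hk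
  have hcomap := GrassmannAlgebra.comap_evD_J k hp
  refine ⟨?_, hcomap⟩
  rw [← Ideal.map_comap_of_surjective _ (GrassmannAlgebra.evD_surjective A (k + 1))
    (GrassmannAlgebra.J (k + 1) p), hcomap, Ideal.map_span]
  congr 1
  ext x
  aesop
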